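/- Let $n\ge 3$, let $D^n\subset\mathbb R^n$ be the closed unit ball, $S^{n-1}=\partial D^n$, and let $G$ be a group. A \emph{generalized cell decomposition} of $D^n$ is a pair $(K,\mathcal U)$ where $K\subset D^n$ is closed with $S^{n-1}\subset K$, $\mathcal U$ is the collection of connected components of $D^n\setminus K$, every $U\in\mathcal U$ is homeomorphic to $\mathrm{int}(D^n)$ with $\partial U$ homeomorphic to $S^{n-1}$, and every sequence of distinct elements of $\mathcal U$ has a subsequence $(U_k)_k$ such that the set of limits of convergent sequences $(x_k)_k$ with $x_k\in U_k$ for all $k$ is a single point. A \emph{$G$-complex} on $D^n$ is a triple $(\mu,K,\mathcal U)$ where $(K,\mathcal U)$ is a generalized cell decomposition of $D^n$ and $\mu:G\to\mathrm{Homeo}(K)$ is an injective map with $\mu(gh)=\mu(h)\circ\mu(g)$ such that for every $g\in G$: $\mu(g)(S^{n-1})=S^{n-1}$, the restriction of $\mu(g)$ to $S^{n-1}$ is orientation preserving, and for every $U\in\mathcal U$ there is a (necessarily unique) cell $\mu(g)(U)\in\mathcal U$ with $\mu(g)(\partial U)=\partial(\mu(g)(U))$; moreover, there are homeomorphisms of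 pairs $\Phi^U:(D^n,S^{n-1})\to(\overline U,\partial U)$, $U\in\mathcal U$, each fixing every point of $S^{n-1}\cap\partial U$, with $\mu(g)\circ\Phi^U=\Phi^{\mu(g)(U)}\circ\mu(g)$ on $S^{n-1}$ for all $g\in G$ and $U\in\mathcal U$. The $G$-complex is \emph{free} if for $g\neq 1$ the map $\mu(g)$ has no fixed point in $K\cap\mathrm{int}(D^n)$. It is a \emph{convergence} $G$-complex if every sequence of distinct elements of $\mu(G)$ has a subsequence that converges, for some $a,b\in K$, to the constant map $a$ uniformly on compact subsets of $K\setminus\{b\}$. A $G$-complex $(\mu_0,K_0,\mathcal U_0)$ is a \emph{refinement} of $(\mu,K,\mathcal U)$ if $K\subset K_0$ and $\mu_0(g)=\mu(g)$ on $K$ for all $g\in G$. Let $(\mu,K,\mathcal U)$ be a free convergence $G$-complex on $D^n$ such that for every $U\in\mathcal U$ the stabilizer $\mathrm{Stab}_\mu(U)=\{g\in G\mid \mu(g)(\partial U)=\partial U\}$ is trivial. Then there exists a free convergence $G$-complex $(\mu_0,D^n,\emptyset)$ that is a refinement of $(\mu,K,\mathcal U)$. In particular, the action of $G$ on $S^{n-1}$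 given by $\mu$ extends to a convergence action of $G$ on $D^n$ that is free on $\mathrm{int}(D^n)$. -/

import Mathlib

namespace GComplexes

open Set Filter Topology CategoryTheory

/-- The closed unit ball `D^n` in Euclidean space `ℝ^n`. -/
abbrev Disk (n : ℕ) : Set (EuclideanSpace ℝ (Fin n)) := Metric.closedBall 0 1

/-- The unit sphere `S^{n-1}`, the boundary of `D^n`. -/
abbrev Sph (n : ℕ) : Set (EuclideanSpace ℝ (Fin n)) := Metric.sphere 0 1

/-- The open unit ball, the interior of `D^n`. -/
abbrev IntDisk (n : ℕ) : Set (EuclideanSpace ℝ (Fin n)) := Metric.ball 0 1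

/-- The set of limits of convergent sequences `(x_m)` with `x_m ∈ U_m` for every `m`. -/
def setLim {X : Type*} [TopologicalSpace X] (U : ℕ → Set X) : Set X :=
  {p | ∃ x : ℕ → X, (∀ m, x m ∈ U m) ∧ Tendsto x atTop (𝓝 p)}

/-- A group of homeomorphisms of `X` is a convergence group if every sequence of distinct elements
has a subsequence that converges to a constant `a`, uniformly on compact subsets of `X \ {b}`,
for some `a, b ∈ X`. -/
def IsConvergenceGroup {X : Type*} [UniformSpace X] (H : Subgroup (X ≃ₜ X)) : Prop :=
  ∀ h : ℕ → (X ≃ₜ X), Function.Injective h → (∀ m, h m ∈ H) →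
    ∃ φ : ℕ → ℕ, StrictMono φ ∧ ∃ a b : X, ∀ C : Set X, IsCompact C → b ∉ C →
      TendstoUniformlyOn (fun k x => h (φ k) x) (fun _ => a) atTop C

/-- A homeomorphism of `S^{n-1}` preserves orientation if it acts as the identity on the
singular homology group `H_{n-1}(S^{n-1}; ℤ)`. -/
def OrientationPreserving {n : ℕ} (f : Sph n ≃ₜ Sph n) : Prop :=
  ((AlgebraicTopology.singularHomologyFunctor (ModuleCat.{0} ℤ) (n - 1)).obj
    (ModuleCat.of ℤ ℤ)).map (TopCat.ofHom (f : C(Sph n, Sph n))) = 𝟙 _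

variable {n : ℕ}

/-- The collection of connected components of `D^n \ K`. -/
def components (K : Set (EuclideanSpace ℝ (Fin n))) : Set (Set (EuclideanSpace ℝ (Fin n))) :=
  {U | ∃ x ∈ Disk n \ K, U = connectedComponentIn (Disk n \ K) x}

/-- `(K, 𝒰)` is a generalized cell decomposition of `D^n`. -/
structure IsCellDecomposition (K : Set (EuclideanSpace ℝ (Fin n)))
    (𝒰 : Set (Set (EuclideanSpace ℝ (Fin n)))) : Prop where
  subset_disk : K ⊆ Disk n
  isClosed : IsClosed K
  cells_eq : 𝒰 = components K
  sphere_subset : Sph n ⊆ K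
  cell_homeo : ∀ U ∈ 𝒰, Nonempty (U ≃ₜ IntDisk n)
  frontier_homeo : ∀ U ∈ 𝒰, Nonempty (frontier U ≃ₜ Sph n)
  exists_lim_eq_singleton : ∀ U : ℕ → Set (EuclideanSpace ℝ (Fin n)), Function.Injective U →
    (∀ m, U m ∈ 𝒰) → ∃ φ : ℕ → ℕ, StrictMono φ ∧ ∃ p, setLim (fun k => U (φ k)) = {p}

variable {G : Type*} [Group G] {K K' : Set (EuclideanSpace ℝ (Fin n))}

/-- The homeomorphism `μ(g)` of `K`. Actions `G → Homeo(K)` are homomorphisms into the opposite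
of the group of homeomorphisms (with composition), so that `μ(gh) = μ(h) ∘ μ(g)`. -/
def act (μ : G →* (K ≃ₜ K)ᵐᵒᵖ) (g : G) : K ≃ₜ K := (μ g).unop

/-- A subset of `ℝ^n` contained in `K` (such as `S^{n-1}`, or the boundary of a component of
`D^n \ K`), regarded as a subset of the space `K`. -/
abbrev within (K A : Set (EuclideanSpace ℝ (Fin n))) : Set K := {x | (x : EuclideanSpace ℝ (Fin n)) ∈ A}

/-- `μ` is a `G`-action on `(K, 𝒰)`: it is faithful, preserves the sphere, permutes the boundaries
of the cells, and restricts to orientation preserving homeomorphisms of the sphere. -/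
structure IsGAction (μ : G →* (K ≃ₜ K)ᵐᵒᵖ) (𝒰 : Set (Set (EuclideanSpace ℝ (Fin n)))) : Prop where
  faithful : Function.Injective μ
  map_sphere : ∀ g, act μ g '' within K (Sph n) = within K (Sph n)
  map_frontier : ∀ g, ∀ U ∈ 𝒰, ∃ U' ∈ 𝒰,
    act μ g '' within K (frontier U) = within K (frontier U')
  orientation : ∀ g, ∃ f : Sph n ≃ₜ Sph n, OrientationPreserving f ∧
    ∀ (x : K) (s : Sph n), (x : EuclideanSpace ℝ (Fin n)) = s →
      (act μ g x : EuclideanSpace ℝ (Fin n)) = f s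

/-- The stabilizer of a cell `U`. -/
def stab (μ : G →* (K ≃ₜ K)ᵐᵒᵖ) (U : Set (EuclideanSpace ℝ (Fin n))) : Set G :=
  {g | act μ g '' within K (frontier U) = within K (frontier U)}

/-- The homeomorphisms `Φ^U : (D^n, S^{n-1}) → (closure of U, ∂U)`, for the cells `U`, fix the
points of `S^{n-1} ∩ ∂U` and are equivariant on the sphere. In `equivariant`, the cell `U'` is
`μ(g)(U)`, `x` is a point of the sphere (called `s` as a point of `D^n`), `s'` is `μ(g)(x)`
and `y` is `Φ^U(x)`; the conclusion is `μ(g)(Φ^U(x)) = Φ^{U'}(μ(g)(x))`. -/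
structure IsMarking (μ : G →* (K ≃ₜ K)ᵐᵒᵖ) (𝒰 : Set (Set (EuclideanSpace ℝ (Fin n))))
    (Φ : ∀ U : 𝒰, Disk n ≃ₜ closure (U : Set (EuclideanSpace ℝ (Fin n)))) : Prop where
  mem_frontier_iff : ∀ (U : 𝒰) (s : Disk n),
    (Φ U s : EuclideanSpace ℝ (Fin n)) ∈ frontier (U : Set (EuclideanSpace ℝ (Fin n))) ↔
      (s : EuclideanSpace ℝ (Fin n)) ∈ Sph n
  fixes : ∀ (U : 𝒰) (s : Disk n), (s : EuclideanSpace ℝ (Fin n)) ∈ Sph n →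
    (s : EuclideanSpace ℝ (Fin n)) ∈ frontier (U : Set (EuclideanSpace ℝ (Fin n))) →
      (Φ U s : EuclideanSpace ℝ (Fin n)) = s
  equivariant : ∀ (g : G) (U U' : 𝒰),
    act μ g '' within K (frontier (U : Set (EuclideanSpace ℝ (Fin n)))) =
        within K (frontier (U' : Set (EuclideanSpace ℝ (Fin n)))) →
      ∀ (x y : K) (s s' : Disk n), (x : EuclideanSpace ℝ (Fin n)) ∈ Sph n →
        (s : EuclideanSpace ℝ (Fin n)) = x →
        (s' : EuclideanSpace ℝ (Fin n)) = act μ g x →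
        (y : EuclideanSpace ℝ (Fin n)) = Φ U s →
        (act μ g y : EuclideanSpace ℝ (Fin n)) = Φ U' s'

/-- The triple `(μ, K, 𝒰)` is a `G`-complex on `D^n`. -/
structure IsGComplex (μ : G →* (K ≃ₜ K)ᵐᵒᵖ) (𝒰 : Set (Set (EuclideanSpace ℝ (Fin n)))) :
    Prop where
  cellDecomposition : IsCellDecomposition K 𝒰
  action : IsGAction μ 𝒰
  exists_marking : ∃ Φ : ∀ U : 𝒰, Disk n ≃ₜ closure (U : Set (EuclideanSpace ℝ (Fin n))),
    IsMarking μ 𝒰 Φ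

/-- Nontrivial elements of `G` have no fixed points in `K ∩ int(D^n)`. -/
def IsFree (μ : G →* (K ≃ₜ K)ᵐᵒᵖ) : Prop :=
  ∀ g : G, g ≠ 1 → ∀ x : K, (x : EuclideanSpace ℝ (Fin n)) ∈ IntDisk n → act μ g x ≠ x

/-- The image `μ(G)` is a convergence group on `K`. -/
def IsConvergence (μ : G →* (K ≃ₜ K)ᵐᵒᵖ) : Prop :=
  IsConvergenceGroup μ.range.unop

/-- The complex with action `μ` on `K` refines the complex with action `μ'` on `K'`:
`K' ⊆ K` and `μ(g) = μ'(g)` on `K'`. -/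
def IsRefinement (μ : G →* (K ≃ₜ K)ᵐᵒᵖ) (μ' : G →* (K' ≃ₜ K')ᵐᵒᵖ) : Prop :=
  K' ⊆ K ∧ ∀ (g : G) (x : K) (x' : K'), (x : EuclideanSpace ℝ (Fin n)) = x' →
    (act μ g x : EuclideanSpace ℝ (Fin n)) = act μ' g x'

end GComplexes

/-!
The marking identifies the closure of each cell `U` with `D^n`, so the radial extension of `μ(g)`
from `S^{n-1}` to `D^n` induces a homeomorphism from the closure of `U` to that of `μ(g)(U)`, which
by equivariance agrees with `μ(g)` on the boundary. These maps are functorial in `g` as soon as a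
cell is determined by its boundary: if `U` and `V` have the same boundary, the two marking maps
agree on `S^{n-1}`, so `Φ^V ∘ (Φ^U)⁻¹` fixes the boundary of `U`, and such a map of the closure of
`U` covers `U`. This is a form of Brouwer's theorem, obtained here from the fact that the integral
of the Jacobian of `id + t (f - id)` is a polynomial in `t` that for small `t` is the volume of the
image.

The diameters of the cells tend to `0`, so a point close to a small cell is close to the boundary of
that cell, and its image is close to the image of a boundary point. Continuity and convergence to a
constant therefore pass from `K` to `D^n`. For points that stay in one cell, convergence holds
because trivial stabilizers make the images of this cell under distinct elements distinct.
-/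

namespace GComplexes

open Set Filter Topology

section Jacobian

open MeasureTheory Metric
open scoped NNReal

variable {E : Type*} [NormedAddCommGroup E]

theorem inter_frontier_nonempty_of_isPreconnected {X : Type*} [TopologicalSpace X] {s t : Set X}
    (ht : IsPreconnected t) (hs : (t ∩ s).Nonempty) (hsc : (t ∩ sᶜ).Nonempty) :
    (t ∩ frontier s).Nonempty := by
  by_contra hempty
  have hfr : ∀ x ∈ t, x ∉ frontier s := fun x hx hxs => hempty ⟨x, hx, hxs⟩
  obtain ⟨x, hxt, hxs⟩ := hs
  obtain ⟨y, hyt, hys⟩ := hsc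
  have hint : ∀ z ∈ t, z ∈ closure s → z ∈ interior s := fun z hz hzs =>
    by_contra fun h => hfr z hz ⟨hzs, h⟩
  have hsub : t ⊆ interior s :=
    ht.subset_of_closure_inter_subset isOpen_interior ⟨x, hxt, hint x hxt (subset_closure hxs)⟩
      fun z hz => hint z hz.2 (closure_mono interior_subset hz.1)
  exact hys (interior_subset (hsub hyt))

theorem lipschitzWith_indicator_of_eqOn_frontier [NormedSpace ℝ E] {F : Type*}
    [NormedAddCommGroup F] {u : E → F} {s : Set E} {L : ℝ≥0} (hs : IsClosed s)
    (hL : LipschitzOnWith L u s) (hu : EqOn u 0 (frontier s)) :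
    LipschitzWith L (s.indicator u) := by
  have key : ∀ x ∈ s, ∀ y ∉ s, ‖u x‖ ≤ L * ‖x - y‖ := by
    intro x hx y hy
    obtain ⟨z, hz, hzs⟩ := inter_frontier_nonempty_of_isPreconnected
      (convex_segment (𝕜 := ℝ) x y).isPreconnected ⟨x, left_mem_segment ℝ x y, hx⟩
      ⟨y, right_mem_segment ℝ x y, hy⟩
    calc ‖u x‖ = ‖u x - u z‖ := by rw [hu hzs, Pi.zero_apply, sub_zero]
      _ ≤ L * ‖x - z‖ := hL.norm_sub_le hx (hs.frontier_subset hzs)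
      _ ≤ L * ‖x - y‖ := by
        gcongr
        rw [← dist_eq_norm, ← dist_eq_norm, ← dist_add_dist_of_mem_segment hz]
        exact le_add_of_nonneg_right dist_nonneg
  refine LipschitzWith.of_dist_le_mul fun x y => ?_
  rw [dist_eq_norm, dist_eq_norm]
  by_cases hx : x ∈ s <;> by_cases hy : y ∈ s
  · simpa only [indicator_of_mem, hx, hy] using hL.norm_sub_le hx hy
  · simpa only [indicator_of_mem hx, indicator_of_notMem hy, sub_zero] using key x hx y hy
  · simpa only [indicator_of_notMem hx, indicator_of_mem hy, zero_sub, norm_neg, norm_sub_rev]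
      using key y hy x hx
  · simp only [indicator_of_notMem hx, indicator_of_notMem hy, sub_self, norm_zero]
    positivity

theorem bijective_id_add_of_lipschitzWith [NormedSpace ℝ E] [CompleteSpace E] {v : E → E} {c : ℝ≥0}
    (hv : LipschitzWith c v) (hc : c < 1) : Function.Bijective fun x => x + v x := by
  have happrox : ApproximatesLinearOn (fun x => x + v x)
      (ContinuousLinearEquiv.refl ℝ E : E →L[ℝ] E) univ c := by
    refine LipschitzOnWith.approximatesLinearOn (LipschitzWith.lipschitzOnWith ?_)
    convert hv using 1
    ext x
    simp
  have hc' : Subsingleton E ∨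
      c < ‖((ContinuousLinearEquiv.refl ℝ E).symm : E →L[ℝ] E)‖₊⁻¹ := by
    rcases subsingleton_or_nontrivial E with h | h
    · exact .inl h
    · refine .inr ?_
      simpa using hc
  exact ⟨injOn_univ.1 (happrox.injOn hc'), happrox.surjective hc'⟩

variable [NormedSpace ℝ E] [FiniteDimensional ℝ E]

theorem det_ne_zero_of_isUnit {A : E →L[ℝ] E} (hA : IsUnit A) : A.det ≠ 0 :=
  (((LinearMap.isUnit_iff_isUnit_det _).1
    (hA.map (ContinuousLinearMap.toLinearMapRingHom (R₁ := ℝ) (M₁ := E)))).ne_zero :)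

theorem det_one_add_pos_of_norm_lt_one {A : E →L[ℝ] E} (hA : ‖A‖ < 1) : 0 < (1 + A).det := by
  have hne : ∀ t ∈ Icc (0 : ℝ) 1, (1 + t • A).det ≠ 0 := by
    intro t ht
    have hnorm : ‖-(t • A)‖ < 1 := by
      rw [norm_neg, norm_smul, Real.norm_of_nonneg ht.1]
      exact (mul_le_of_le_one_left (norm_nonneg A) ht.2).trans_lt hA
    simpa only [sub_neg_eq_add] using det_ne_zero_of_isUnit (isUnit_one_sub_of_norm_lt_one hnorm)
  have hcont : Continuous fun t : ℝ => (1 + t • A).det :=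
    ContinuousLinearMap.continuous_det.comp (by fun_prop)
  by_contra! hneg
  obtain ⟨t, ht, ht0⟩ := intermediate_value_Icc' zero_le_one hcont.continuousOn
    (show (0 : ℝ) ∈ Icc _ _ from ⟨by simpa using hneg, by simp [ContinuousLinearMap.det]⟩)
  exact hne t ht ht0

theorem exists_polynomial_eval_eq_det (A : E →L[ℝ] E) :
    ∃ p : Polynomial ℝ, p.natDegree ≤ Module.finrank ℝ E ∧
      ∀ t : ℝ, p.eval t = (1 + t • A).det := by
  let b := Module.finBasis ℝ E
  let M := LinearMap.toMatrix b b (A : E →ₗ[ℝ] E)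
  refine ⟨((Polynomial.X : Polynomial ℝ) • M.map Polynomial.C +
    (1 : Matrix _ _ ℝ).map Polynomial.C).det, ?_, fun t => ?_⟩
  · simpa using Polynomial.natDegree_det_X_add_C_le M 1
  · have hM : LinearMap.toMatrix b b ((1 + t • A : E →L[ℝ] E) : E →ₗ[ℝ] E) = 1 + t • M := by
      have : ((1 + t • A : E →L[ℝ] E) : E →ₗ[ℝ] E) = LinearMap.id + t • (A : E →ₗ[ℝ] E) := rfl
      rw [this, map_add, map_smul, LinearMap.toMatrix_id]
    rw [ContinuousLinearMap.det, ← LinearMap.det_toMatrix b, hM, ← Polynomial.coe_evalRingHom,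
      RingHom.map_det]
    congr 1
    ext i j
    simp [add_comm, Matrix.one_apply, apply_ite]
    ring

theorem exists_polynomial_eval_eq_integral {α : Type*} [MeasurableSpace α] {ν : Measure α}
    {p : α → Polynomial ℝ} {d : ℕ} (hd : ∀ x, (p x).natDegree ≤ d)
    (hint : ∀ t, Integrable (fun x => (p x).eval t) ν) :
    ∃ q : Polynomial ℝ, ∀ t, q.eval t = ∫ x, (p x).eval t ∂ν := by
  let s := Finset.range (d + 1)
  let node : ℕ → ℝ := fun i => i
  have hinterp : ∀ x, p x = ∑ i ∈ s, Polynomial.C ((p x).eval (node i)) * Lagrange.basis s node i :=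
    fun x => Lagrange.eq_interpolate (Nat.cast_injective.injOn) <|
      Polynomial.degree_le_natDegree.trans_lt <| by
        rw [Finset.card_range]
        exact_mod_cast Nat.lt_succ_of_le (hd x)
  refine ⟨∑ i ∈ s, Polynomial.C (∫ x, (p x).eval (node i) ∂ν) * Lagrange.basis s node i,
    fun t => ?_⟩
  simp only [Polynomial.eval_finsetSum, Polynomial.eval_mul, Polynomial.eval_C]
  simp_rw [← integral_mul_const]
  rw [← integral_finsetSum _ fun i _ => (hint (node i)).mul_const _]
  refine integral_congr_ae (.of_forall fun x => ?_)
  simpa only [Polynomial.eval_finsetSum, Polynomial.eval_mul, Polynomial.eval_C] using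
    (congrArg (Polynomial.eval t) (hinterp x)).symm

variable [MeasurableSpace E] [BorelSpace E] {ν : Measure E} {s : Set E}

theorem exists_polynomial_eval_eq_setIntegral_det [IsFiniteMeasureOnCompacts ν]
    {A : E → E →L[ℝ] E} (hA : Continuous A) (hs : Bornology.IsBounded s) :
    ∃ q : Polynomial ℝ, ∀ t : ℝ, q.eval t = ∫ x in s, (1 + t • A x).det ∂ν := by
  choose p hdeg hp using fun x => exists_polynomial_eval_eq_det (A x)
  simp only [← hp]
  refine exists_polynomial_eval_eq_integral hdeg fun t => ?_
  have hcont : Continuous fun x => (1 + t • A x).det :=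
    ContinuousLinearMap.continuous_det.comp (continuous_const.add (hA.const_smul t))
  simp only [hp]
  exact (hcont.continuousOn.integrableOn_compact hs.isCompact_closure).mono_set subset_closure

variable [ν.IsAddHaarMeasure]

theorem setIntegral_det_one_add_of_lipschitzOnWith {v : E → E} {v' : E → E →L[ℝ] E} {c : ℝ≥0}
    (hs : IsOpen s) (hv : LipschitzOnWith c v (closure s)) (hc : c < 1)
    (hv0 : EqOn v 0 (frontier s)) (hv' : ∀ x ∈ s, HasFDerivAt v (v' x) x) :
    ∫ x in s, (1 + v' x).det ∂ν = ν.real s := by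
  let w := (closure s).indicator v
  have hws : EqOn w v s := fun x hx => indicator_of_mem (subset_closure hx) v
  have hws' : EqOn w 0 sᶜ := fun x hx => by
    by_cases hxs : x ∈ closure s
    · exact (indicator_of_mem hxs v).trans (hv0 (hs.frontier_eq ▸ ⟨hxs, hx⟩))
    · exact indicator_of_notMem hxs v
  have hw : LipschitzWith c w := lipschitzWith_indicator_of_eqOn_frontier isClosed_closure hv
    (hv0.mono frontier_closure_subset)
  have hw' : ∀ x ∈ s, HasFDerivAt w (v' x) x := fun x hx =>
    (hv' x hx).congr_of_eventuallyEq (hws.eventuallyEq_of_mem (hs.mem_nhds hx))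
  have hbij : Function.Bijective (id + w) := bijective_id_add_of_lipschitzWith hw hc
  have himage : (id + w) '' s = s := by
    have hcompl : BijOn (id + w) sᶜ sᶜ := (bijOn_id _).congr fun x hx => by simp [hws' hx]
    simpa only [compl_compl] using (hcompl.compl hbij).image_eq
  calc ∫ x in s, (1 + v' x).det ∂ν
      = ∫ x in s, |(1 + v' x).det| • (1 : ℝ) ∂ν :=
        setIntegral_congr_fun hs.measurableSet fun x hx => by
          rw [abs_of_pos (det_one_add_pos_of_norm_lt_one
            (((hw' x hx).le_of_lipschitz hw).trans_lt (by exact_mod_cast hc))),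
            smul_eq_mul, mul_one]
    _ = ∫ _ in (id + w) '' s, (1 : ℝ) ∂ν :=
        (integral_image_eq_integral_abs_det_fderiv_smul ν hs.measurableSet
          (fun x hx => ((hasFDerivAt_id x).add (hw' x hx)).hasFDerivWithinAt)
          hbij.injective.injOn fun _ => (1 : ℝ)).symm
    _ = ν.real s := by
        rw [himage, setIntegral_const, smul_eq_mul, mul_one]

theorem setIntegral_det_fderiv_of_eqOn_frontier {f : E → E} (hf : ContDiff ℝ 1 f) (hs : IsOpen s)
    (hconv : Convex ℝ s) (hbdd : Bornology.IsBounded s) (hid : EqOn f id (frontier s)) :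
    ∫ x in s, (fderiv ℝ f x).det ∂ν = ν.real s := by
  let u := f - id
  have hu : ContDiff ℝ 1 u := hf.sub contDiff_id
  have hu' : ∀ x, HasFDerivAt u (fderiv ℝ u x) x := fun x =>
    (hu.differentiable one_ne_zero x).hasFDerivAt
  obtain ⟨L, hL⟩ := hu.contDiffOn.exists_lipschitzOnWith (n := 1) one_ne_zero
    hconv.closure hbdd.isCompact_closure
  obtain ⟨q, hq⟩ := exists_polynomial_eval_eq_setIntegral_det (ν := ν)
    (hu.continuous_fderiv one_ne_zero) hbdd
  have hsmall : ∀ t ∈ Ioo (0 : ℝ) (1 / (L + 1)), q.eval t = ν.real s := by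
    intro t ht
    lift t to ℝ≥0 using ht.1.le
    have htL : t * L < 1 := by
      have : (t : ℝ) * (L + 1) < 1 := (lt_div_iff₀ (by positivity)).1 ht.2
      have : (t : ℝ) * L < 1 := by linarith [t.coe_nonneg]
      exact_mod_cast this
    rw [hq]
    have hLt : LipschitzOnWith (t * L) (fun x => (t : ℝ) • u x) (closure s) := by
      simpa only [NNReal.nnnorm_eq] using! (lipschitzWith_smul (t : ℝ)).comp_lipschitzOnWith hL
    exact setIntegral_det_one_add_of_lipschitzOnWith hs hLt htL
      (fun x hx => by simp [u, hid hx]) fun x _ => (hu' x).const_smul (t : ℝ)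
  have hq_const : q = Polynomial.C (ν.real s) :=
    Polynomial.eq_of_infinite_eval_eq _ _ <|
      (Ioo_infinite (show (0 : ℝ) < 1 / (L + 1) by positivity)).mono fun t ht => by
        simpa using hsmall t ht
  have hfderiv : ∀ x, fderiv ℝ f x = 1 + (1 : ℝ) • fderiv ℝ u x := fun x => by
    have hfu : HasFDerivAt (id + u) (1 + fderiv ℝ u x) x := (hasFDerivAt_id x).add (hu' x)
    rw [one_smul, ← hfu.fderiv, add_sub_cancel]
  simp only [hfderiv, ← hq, hq_const, Polynomial.eval_C]

end Jacobian

section Surjectivity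

open MeasureTheory Metric

variable {E : Type*} [NormedAddCommGroup E] [InnerProductSpace ℝ E] [FiniteDimensional ℝ E]

theorem det_eq_zero_of_norm_eventuallyEq_const {f : E → E} {f' : E →L[ℝ] E} {x : E} {ρ : ℝ}
    (hf : HasFDerivAt f f' x) (hρ : ρ ≠ 0) (hfρ : ∀ᶠ y in 𝓝 x, ‖f y‖ = ρ) : f'.det = 0 := by
  have horth : ∀ v, inner ℝ (f x) (f' v) = 0 := by
    have hconst : HasFDerivAt (fun y => ‖f y‖ ^ 2) (0 : E →L[ℝ] ℝ) x :=
      (hasFDerivAt_const (ρ ^ 2) x).congr_of_eventuallyEq (hfρ.mono fun y hy => by simp [hy])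
    intro v
    simpa using congrArg (fun T : E →L[ℝ] ℝ => T v) (hf.norm_sq.unique hconst)
  by_contra hdet
  have hunit : IsUnit (f' : E →ₗ[ℝ] E) :=
    (LinearMap.isUnit_iff_isUnit_det _).2 (isUnit_iff_ne_zero.2 hdet)
  obtain ⟨v, hv⟩ := ((Module.End.isUnit_iff _).1 hunit).surjective (f x)
  have hzero : ‖f x‖ ^ 2 = 0 := by
    rw [← real_inner_self_eq_norm_sq]
    conv_lhs => rw [← hv]
    exact hv ▸ horth v
  rw [hfρ.self_of_nhds] at hzero
  exact hρ (pow_eq_zero_iff two_ne_zero |>.1 hzero)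

theorem exists_mem_ball_norm_ne_of_eqOn_sphere {f : E → E} {ρ : ℝ} (hρ : 0 < ρ)
    (hf : ContDiff ℝ 1 f) (hid : EqOn f id (sphere 0 ρ)) : ∃ x ∈ ball 0 ρ, ‖f x‖ ≠ ρ := by
  by_contra! hnorm
  let _ : MeasurableSpace E := borel E
  have : BorelSpace E := ⟨rfl⟩
  have hvolume := setIntegral_det_fderiv_of_eqOn_frontier (ν := volume) hf isOpen_ball
    (convex_ball 0 ρ) isBounded_ball (hid.mono frontier_ball_subset_sphere)
  have hzero : ∀ x ∈ ball (0 : E) ρ, (fderiv ℝ f x).det = 0 := fun x hx =>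
    det_eq_zero_of_norm_eventuallyEq_const (hf.differentiable one_ne_zero x).hasFDerivAt hρ.ne' <|
      (isOpen_ball.eventually_mem hx).mono hnorm
  rw [setIntegral_congr_fun measurableSet_ball hzero, integral_zero] at hvolume
  exact (ENNReal.toReal_pos (measure_ball_pos _ _ hρ).ne' measure_ball_lt_top.ne).ne hvolume

theorem surjective_of_eqOn_id_compl_isBounded {F : E → E} {s : Set E} (hF : Continuous F)
    (hs : Bornology.IsBounded s) (hid : EqOn F id sᶜ) : Function.Surjective F := by
  intro a
  by_contra! hne
  let H : E → E := fun x => F (x + a) - a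
  have hH : Continuous H := by fun_prop
  have hH0 : ∀ x, H x ≠ 0 := fun x => sub_ne_zero.2 (hne _)
  obtain ⟨R, hR⟩ := hs.subset_ball a
  have hHid : ∀ x, R ≤ ‖x‖ → H x = x := fun x hx => by
    have hxs : x + a ∉ s := fun h => by
      have hxR : ‖x‖ < R := by simpa using hR h
      exact hxR.not_ge hx
    simp [H, hid hxs]
  obtain ⟨g, hg, hgH, hgS, -⟩ := hH.exists_contDiff_approx_and_eqOn 1 (ε := fun x => ‖H x‖)
    hH.norm (fun x => norm_pos_iff.2 (hH0 x)) (S := {x | |R| + 1 ≤ ‖x‖}) (U := {x | |R| < ‖x‖})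
    (isClosed_le continuous_const continuous_norm)
    ((isOpen_lt continuous_const continuous_norm).mem_nhdsSet.2 fun x hx =>
      (lt_add_one |R|).trans_le hx)
    (contDiffOn_id.congr fun x hx => hHid x ((le_abs_self R).trans (le_of_lt hx)))
  have hg0 : ∀ x, g x ≠ 0 := fun x h => by simpa [h] using hgH x
  have hρ : 0 < |R| + 1 := by positivity
  obtain ⟨x, -, hx⟩ := exists_mem_ball_norm_ne_of_eqOn_sphere hρ
    (f := fun x => ((|R| + 1) * ‖g x‖⁻¹) • g x)
    ((contDiff_const.mul ((hg.norm ℝ hg0).inv fun x => norm_ne_zero_iff.2 (hg0 x))).smul hg)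
    fun x hx => by
      have hxR : ‖x‖ = |R| + 1 := mem_sphere_zero_iff_norm.1 hx
      have hgx : g x = x := (hgS hxR.ge).trans (hHid x (by linarith [le_abs_self R]))
      simp [hgx, hxR, hρ.ne']
  refine hx ?_
  rw [norm_smul, norm_mul, norm_inv, norm_norm, Real.norm_of_nonneg hρ.le, mul_assoc,
    inv_mul_cancel₀ (norm_ne_zero_iff.2 (hg0 x)), mul_one]

theorem subset_range_of_eqOn_frontier {s : Set E} (hs : Bornology.IsBounded s)
    (T : C(closure s, E)) (hT : ∀ x : closure s, (x : E) ∈ frontier s → T x = x) :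
    s ⊆ range T := by
  obtain ⟨F, hF⟩ := ContinuousMap.exists_restrict_eq isClosed_closure T
  classical
  have hFT : ∀ x : closure s, F x = T x := fun x => congrArg (· x) hF
  have hcont : Continuous (s.piecewise F id) :=
    F.continuous.piecewise (fun x hx => (hFT ⟨x, hx.1⟩).trans (hT ⟨x, hx.1⟩ hx)) continuous_id
  intro y hy
  obtain ⟨x, rfl⟩ := surjective_of_eqOn_id_compl_isBounded hcont hs
    (fun x hx => piecewise_eq_of_notMem s _ _ hx) y
  have hxs : x ∈ s := by
    by_contra hx
    rw [piecewise_eq_of_notMem s F id hx] at hy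
    exact hx hy
  exact ⟨⟨x, subset_closure hxs⟩, by simp [hxs, ← hFT]⟩

end Surjectivity

section NullDecomposition

theorem tendstoLocallyUniformlyOn_const_iff {X Y κ : Type*} [TopologicalSpace X] [UniformSpace Y]
    {F : κ → X → Y} {c : Y} {l : Filter κ} {s : Set X} :
    TendstoLocallyUniformlyOn F (fun _ => c) l s ↔
      ∀ p ∈ s, Tendsto (fun q : κ × X => F q.1 q.2) (l ×ˢ 𝓝[s] p) (𝓝 c) :=
  tendstoLocallyUniformlyOn_iff_filter.trans
    (forall₂_congr fun _ _ => tendsto_prod_filter_iff.symm)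

theorem tendstoLocallyUniformlyOn_const_subtype_iff {X κ : Type*} [UniformSpace X] {s : Set X}
    {F : κ → s → s} {f : κ → X → X} (hf : ∀ k (x : s), F k x = f k x) {a b : s} {l : Filter κ} :
    TendstoLocallyUniformlyOn F (fun _ => a) l {b}ᶜ ↔
      TendstoLocallyUniformlyOn f (fun _ => (a : X)) l (s \ {↑b}) := by
  have hmap : ∀ p : s, l ×ˢ 𝓝[s \ {↑b}] (p : X) =
      map (Prod.map id Subtype.val) (l ×ˢ 𝓝[{b}ᶜ] p) := fun p => by
    rw [← prod_map_map_eq', map_id, IsEmbedding.subtypeVal.map_nhdsWithin_eq, image_val_compl,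
      image_singleton]
  have hiff : ∀ p : s, Tendsto (fun q : κ × s => F q.1 q.2) (l ×ˢ 𝓝[{b}ᶜ] p) (𝓝 a) ↔
      Tendsto (fun q : κ × X => f q.1 q.2) (l ×ˢ 𝓝[s \ {↑b}] (p : X)) (𝓝 (a : X)) := fun p => by
    rw [hmap, tendsto_map'_iff, tendsto_subtype_rng]
    simp only [hf, Function.comp_def, Prod.map, id]
  simp only [tendstoLocallyUniformlyOn_const_iff, hiff]
  exact ⟨fun h p hp => h ⟨p, hp.1⟩ fun hpb => hp.2 (congrArg Subtype.val hpb),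
    fun h p hp => h p ⟨p.2, fun hpb => hp (Subtype.ext hpb)⟩⟩

theorem tendsto_cofinite_or_eventually_eq {α ι : Type*} (𝓕 : Ultrafilter α) (u : α → ι) :
    Tendsto u 𝓕 cofinite ∨ ∃ i, ∀ᶠ t in 𝓕, u t = i :=
  (𝓕.map u).le_cofinite_or_eq_pure.imp id fun ⟨i, hi⟩ =>
    ⟨i, (hi ▸ Ultrafilter.mem_pure.2 rfl : {i} ∈ 𝓕.map u)⟩

variable {X ι κ α : Type*} [MetricSpace X] {D K : Set X} {C : ι → Set X}

theorem tendsto_of_tendstoLocallyUniformlyOn_const {s : Set X} {f : κ → X → X} {l : Filter κ}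
    {a b : X} (hs : IsClosed s)
    (hf : TendstoLocallyUniformlyOn f (fun _ => a) l (s \ {b})) {𝓕 : Filter α} [𝓕.NeBot]
    {k : α → κ} {x : α → X} {p : X} (hk : Tendsto k 𝓕 l) (hx : Tendsto x 𝓕 (𝓝 p)) (hpb : p ≠ b)
    (hxs : ∀ᶠ t in 𝓕, x t ∈ s) : Tendsto (fun t => f (k t) (x t)) 𝓕 (𝓝 a) := by
  have hps : p ∈ s := hs.mem_of_tendsto hx hxs
  have hx' : Tendsto x 𝓕 (𝓝[s \ {b}] p) := tendsto_nhdsWithin_iff.2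
    ⟨hx, hxs.and (hx.eventually_ne hpb)⟩
  exact (tendstoLocallyUniformlyOn_const_iff.1 hf p ⟨hps, hpb⟩).comp (hk.prodMk hx')

/-- `D` is covered by a closed set `K` and a null family of bounded cells `C i`, one whose diameters
tend to `0`, such that the boundary of each cell lies in `K` and has at least two points. -/
structure IsNullDecomposition (D K : Set X) (C : ι → Set X) : Prop where
  isClosed : IsClosed K
  subset_union : D ⊆ K ∪ ⋃ i, C i
  isBounded : ∀ i, Bornology.IsBounded (C i)
  tendsto_diam : Tendsto (fun i => Metric.diam (C i)) cofinite (𝓝 0)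
  frontier_subset : ∀ i, frontier (C i) ⊆ K
  frontier_nontrivial : ∀ i, (frontier (C i)).Nontrivial

namespace IsNullDecomposition

theorem tendsto_of_mem_closure (h : IsNullDecomposition D K C) {𝓕 : Filter α} {u : α → ι}
    {x y : α → X} {p : X} (hu : Tendsto u 𝓕 cofinite) (hx : ∀ᶠ t in 𝓕, x t ∈ closure (C (u t)))
    (hy : ∀ᶠ t in 𝓕, y t ∈ closure (C (u t))) (hxp : Tendsto x 𝓕 (𝓝 p)) : Tendsto y 𝓕 (𝓝 p) := by
  refine (tendsto_iff_of_dist ?_).1 hxp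
  refine squeeze_zero' (.of_forall fun _ => dist_nonneg) ?_ (h.tendsto_diam.comp hu)
  filter_upwards [hx, hy] with t hxt hyt
  exact (Metric.dist_le_diam_of_mem (h.isBounded _).closure hxt hyt).trans_eq
    (Metric.diam_closure _)

theorem eventually_mem_or (h : IsNullDecomposition D K C) {𝓕 : Ultrafilter α} {x : α → X}
    (hx : ∀ᶠ t in 𝓕, x t ∈ D) :
    (∀ᶠ t in 𝓕, x t ∈ K) ∨ (∃ i, ∀ᶠ t in 𝓕, x t ∈ C i) ∨
      ∃ u : α → ι, Tendsto u 𝓕 cofinite ∧ ∀ᶠ t in 𝓕, x t ∈ C (u t) := by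
  refine (Ultrafilter.eventually_or.1 (hx.mono fun t ht => h.subset_union ht)).imp_right
    fun hC => ?_
  obtain ⟨u, hu⟩ := Eventually.choice (hC.mono fun t ht => mem_iUnion.1 ht)
  rcases tendsto_cofinite_or_eventually_eq 𝓕 u with hcof | ⟨i, hi⟩
  · exact .inr ⟨u, hcof, hu⟩
  · exact .inl ⟨i, (hu.and hi).mono fun t ht => ht.2 ▸ ht.1⟩

theorem continuousOn_of_mapsTo_closure (h : IsNullDecomposition D K C) {f : X → X} {σ : ι → ι}
    (hK : ContinuousOn f K) (hC : ∀ i, ContinuousOn f (closure (C i))) (hσ : Function.Injective σ)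
    (hmaps : ∀ i, MapsTo f (closure (C i)) (closure (C (σ i)))) : ContinuousOn f D := by
  intro p _
  refine (tendsto_iff_ultrafilter _ _ _).2 fun 𝓕 h𝓕 => ?_
  have hlim : Tendsto id 𝓕 (𝓝 p) := h𝓕.trans nhdsWithin_le_nhds
  rcases h.eventually_mem_or (x := id) (h𝓕 self_mem_nhdsWithin) with hmem | ⟨i, hmem⟩ |
    ⟨u, hu, hmem⟩
  · exact (hK p (h.isClosed.mem_of_tendsto hlim hmem)).mono_left
      (tendsto_nhdsWithin_iff.2 ⟨hlim, hmem⟩)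
  · have hmem' : ∀ᶠ x in 𝓕, x ∈ closure (C i) := hmem.mono fun _ hx => subset_closure hx
    exact (hC i p (isClosed_closure.mem_of_tendsto hlim hmem')).mono_left
      (tendsto_nhdsWithin_iff.2 ⟨hlim, hmem'⟩)
  · have hmem' : ∀ᶠ x in 𝓕, x ∈ closure (C (u x)) := hmem.mono fun _ hx => subset_closure hx
    choose y hy using fun i => (h.frontier_nontrivial i).nonempty
    have hylim : Tendsto (y ∘ u) 𝓕 (𝓝 p) :=
      h.tendsto_of_mem_closure hu hmem' (.of_forall fun x => (hy (u x)).1) hlim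
    have hyK : ∀ᶠ x in 𝓕, (y ∘ u) x ∈ K := .of_forall fun x => h.frontier_subset _ (hy (u x))
    have hfy : Tendsto (f ∘ y ∘ u) 𝓕 (𝓝 (f p)) :=
      (hK p (h.isClosed.mem_of_tendsto hylim hyK)).tendsto.comp
        (tendsto_nhdsWithin_iff.2 ⟨hylim, hyK⟩)
    exact h.tendsto_of_mem_closure (hσ.tendsto_cofinite.comp hu)
      (.of_forall fun x => hmaps _ (hy (u x)).1) (hmem'.mono fun x hx => hmaps _ hx) hfy

section Convergence

variable {f : κ → X → X} {σ : κ → ι → ι} {l : Filter κ} {a b : X}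

theorem tendsto_cofinite_of_surjOn_frontier (h : IsNullDecomposition D K C)
    (hsurj : ∀ k i, SurjOn (f k) (frontier (C i)) (frontier (C (σ k i))))
    (hf : TendstoLocallyUniformlyOn f (fun _ => a) l (K \ {b})) {𝓕 : Ultrafilter α} {k : α → κ}
    {u : α → ι} {x : α → X} {p : X} (hk : Tendsto k 𝓕 l) (hu : Tendsto u 𝓕 cofinite)
    (hxu : ∀ᶠ t in 𝓕, x t ∈ closure (C (u t))) (hxp : Tendsto x 𝓕 (𝓝 p)) (hpb : p ≠ b) :
    Tendsto (fun t => σ (k t) (u t)) 𝓕 cofinite := by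
  refine (tendsto_cofinite_or_eventually_eq 𝓕 _).resolve_right ?_
  rintro ⟨j, hσj⟩
  obtain ⟨z, hz, hza⟩ := (h.frontier_nontrivial j).exists_ne a
  obtain ⟨w, hw⟩ := Eventually.choice (hσj.mono fun t ht => hsurj (k t) (u t) (ht.symm ▸ hz))
  have hwp : Tendsto w 𝓕 (𝓝 p) :=
    h.tendsto_of_mem_closure hu hxu (hw.mono fun t ht => ht.1.1) hxp
  have hfw : Tendsto (fun t => f (k t) (w t)) 𝓕 (𝓝 a) :=
    tendsto_of_tendstoLocallyUniformlyOn_const h.isClosed hf hk hwp hpb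
      (hw.mono fun t ht => h.frontier_subset _ ht.1)
  have hfz : Tendsto (fun t => f (k t) (w t)) 𝓕 (𝓝 z) :=
    tendsto_const_nhds.congr' (hw.mono fun t ht => ht.2.symm)
  exact hza (tendsto_nhds_unique hfz hfw)

theorem tendstoLocallyUniformlyOn_const (h : IsNullDecomposition D K C)
    (hmaps : ∀ k i, MapsTo (f k) (closure (C i)) (closure (C (σ k i))))
    (hsurj : ∀ k i, SurjOn (f k) (frontier (C i)) (frontier (C (σ k i))))
    (hσ : ∀ i, Tendsto (σ · i) l cofinite)
    (hf : TendstoLocallyUniformlyOn f (fun _ => a) l (K \ {b})) :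
    TendstoLocallyUniformlyOn f (fun _ => a) l (D \ {b}) := by
  refine tendstoLocallyUniformlyOn_const_iff.2 fun p hp => ?_
  refine (tendsto_iff_ultrafilter _ _ _).2 fun 𝓕 h𝓕 => ?_
  have hk : Tendsto (Prod.fst : κ × X → κ) 𝓕 l := Tendsto.mono_left tendsto_fst h𝓕
  obtain ⟨hx, hxD⟩ : Tendsto (Prod.snd : κ × X → X) 𝓕 (𝓝 p) ∧ ∀ᶠ t : κ × X in 𝓕, t.2 ∈ D \ {b} :=
    tendsto_nhdsWithin_iff.1 (Tendsto.mono_left tendsto_snd h𝓕)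
  rcases h.eventually_mem_or (hxD.mono fun _ ht => ht.1) with hmem | ⟨i, hmem⟩ | ⟨u, hu, hmem⟩
  · exact tendsto_of_tendstoLocallyUniformlyOn_const h.isClosed hf hk hx hp.2 hmem
  · obtain ⟨y, hy, hyb⟩ := (h.frontier_nontrivial i).exists_ne b
    have hfy : Tendsto (fun t : κ × X => f t.1 y) 𝓕 (𝓝 a) :=
      tendsto_of_tendstoLocallyUniformlyOn_const h.isClosed hf hk tendsto_const_nhds hyb
        (.of_forall fun _ => h.frontier_subset i hy)
    exact h.tendsto_of_mem_closure ((hσ i).comp hk) (.of_forall fun t => hmaps t.1 i hy.1)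
      (hmem.mono fun t ht => hmaps t.1 i (subset_closure ht)) hfy
  · have hmem' : ∀ᶠ t in 𝓕, t.2 ∈ closure (C (u t)) := hmem.mono fun _ ht => subset_closure ht
    choose y hy using fun i => (h.frontier_nontrivial i).nonempty
    have hylim : Tendsto (y ∘ u) 𝓕 (𝓝 p) :=
      h.tendsto_of_mem_closure hu hmem' (.of_forall fun t => (hy (u t)).1) hx
    have hfy : Tendsto (fun t : κ × X => f t.1 (y (u t))) 𝓕 (𝓝 a) :=
      tendsto_of_tendstoLocallyUniformlyOn_const h.isClosed hf hk hylim hp.2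
        (.of_forall fun t => h.frontier_subset _ (hy (u t)))
    exact h.tendsto_of_mem_closure
      (h.tendsto_cofinite_of_surjOn_frontier hsurj hf hk hu hmem' hx hp.2)
      (.of_forall fun t => hmaps t.1 _ (hy (u t)).1) (hmem'.mono fun t ht => hmaps t.1 _ ht) hfy

end Convergence

end IsNullDecomposition

end NullDecomposition

section Cone

variable {E : Type*} [NormedAddCommGroup E] [NormedSpace ℝ E]
  {f g : Metric.sphere (0 : E) 1 → Metric.sphere (0 : E) 1}

theorem norm_inv_smul_mem_sphere {x : E} (hx : x ≠ 0) :
    ‖x‖⁻¹ • x ∈ Metric.sphere (0 : E) 1 := by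
  rw [mem_sphere_zero_iff_norm, norm_smul, norm_inv, norm_norm,
    inv_mul_cancel₀ (norm_ne_zero_iff.2 hx)]

open Classical in
/-- The cone of a self-map of the unit sphere: its positively homogeneous extension to the whole
space, which sends `0` to `0`. -/
noncomputable def coneMap (f : Metric.sphere (0 : E) 1 → Metric.sphere (0 : E) 1) (x : E) : E :=
  if hx : x = 0 then 0 else ‖x‖ • (f ⟨‖x‖⁻¹ • x, norm_inv_smul_mem_sphere hx⟩ : E)

@[simp]
theorem coneMap_zero : coneMap f 0 = 0 := dif_pos rfl

theorem coneMap_of_ne_zero {x : E} (hx : x ≠ 0) :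
    coneMap f x = ‖x‖ • (f ⟨‖x‖⁻¹ • x, norm_inv_smul_mem_sphere hx⟩ : E) :=
  dif_neg hx

theorem norm_coneMap (x : E) : ‖coneMap f x‖ = ‖x‖ := by
  rcases eq_or_ne x 0 with rfl | hx
  · rw [coneMap_zero]
  · rw [coneMap_of_ne_zero hx, norm_smul, norm_norm, norm_eq_of_mem_sphere, mul_one]

theorem coneMap_mem_closedBall {x : E} {r : ℝ} (hx : x ∈ Metric.closedBall 0 r) :
    coneMap f x ∈ Metric.closedBall 0 r := by
  rwa [mem_closedBall_zero_iff, norm_coneMap, ← mem_closedBall_zero_iff]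

theorem coneMap_coe (s : Metric.sphere (0 : E) 1) : coneMap f s = f s := by
  have hs : (s : E) ≠ 0 := ne_zero_of_mem_unit_sphere s
  simp only [coneMap_of_ne_zero hs, norm_eq_of_mem_sphere, inv_one, one_smul, Subtype.coe_eta]

theorem coneMap_id (x : E) : coneMap id x = x := by
  rcases eq_or_ne x 0 with rfl | hx
  · exact coneMap_zero
  · rw [coneMap_of_ne_zero hx, id, smul_smul, mul_inv_cancel₀ (norm_ne_zero_iff.2 hx), one_smul]

theorem coneMap_comp (x : E) : coneMap (g ∘ f) x = coneMap g (coneMap f x) := by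
  rcases eq_or_ne x 0 with rfl | hx
  · simp only [coneMap_zero]
  · have hfx : coneMap f x ≠ 0 := by rwa [← norm_ne_zero_iff, norm_coneMap, norm_ne_zero_iff]
    simp only [coneMap_of_ne_zero hfx, norm_coneMap]
    simp only [coneMap_of_ne_zero hx, smul_smul, inv_mul_cancel₀ (norm_ne_zero_iff.2 hx), one_smul,
      Function.comp_apply, Subtype.coe_eta]

theorem continuous_coneMap (hf : Continuous f) : Continuous (coneMap f) := by
  refine continuous_iff_continuousAt.2 fun x => ?_
  rcases eq_or_ne x 0 with rfl | hx
  · rw [ContinuousAt, coneMap_zero, tendsto_zero_iff_norm_tendsto_zero]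
    simp only [norm_coneMap]
    exact tendsto_norm_zero
  · have hcont : ContinuousOn (coneMap f) {0}ᶜ := by
      rw [continuousOn_iff_continuous_domRestrict]
      have hnorm : Continuous fun y : ({0}ᶜ : Set E) => ‖(y : E)‖ := by fun_prop
      have heq : ({0}ᶜ : Set E).domRestrict (coneMap f) = fun y : ({0}ᶜ : Set E) => ‖(y : E)‖ •
          (f ⟨‖(y : E)‖⁻¹ • (y : E), norm_inv_smul_mem_sphere y.2⟩ : E) :=
        funext fun y => coneMap_of_ne_zero y.2
      rw [heq]
      exact hnorm.smul (continuous_subtype_val.comp (hf.comp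
        (((hnorm.inv₀ fun y => norm_ne_zero_iff.2 y.2).smul continuous_subtype_val).subtype_mk _)))
    exact hcont.continuousAt (isOpen_compl_singleton.mem_nhds hx)

end Cone

section CellDecomposition

variable {n : ℕ} {K : Set (EuclideanSpace ℝ (Fin n))} {𝒰 : Set (Set (EuclideanSpace ℝ (Fin n)))}
  {U V : Set (EuclideanSpace ℝ (Fin n))}

theorem nontrivial_sphere (hn : n ≠ 0) : Nontrivial (Sph n) := by
  have : NeZero n := ⟨hn⟩
  obtain ⟨x⟩ : Nonempty (Sph n) := (NormedSpace.sphere_nonempty.2 zero_le_one).to_subtype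
  exact ⟨x, -x, ne_neg_of_mem_unit_sphere ℝ x⟩

namespace IsCellDecomposition

theorem isOpen_disk_diff (h : IsCellDecomposition K 𝒰) : IsOpen (Disk n \ K) := by
  have heq : Disk n \ K = IntDisk n \ K := by
    rw [Disk, ← Metric.ball_union_sphere, union_sdiff_distrib, sdiff_eq_empty.2 h.sphere_subset,
      union_empty]
  exact heq ▸ Metric.isOpen_ball.sdiff h.isClosed

theorem isOpen_cell (h : IsCellDecomposition K 𝒰) (hU : U ∈ 𝒰) : IsOpen U := by
  obtain ⟨x, -, rfl⟩ := h.cells_eq ▸ hU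
  exact h.isOpen_disk_diff.connectedComponentIn

theorem cell_subset (h : IsCellDecomposition K 𝒰) (hU : U ∈ 𝒰) : U ⊆ Disk n \ K := by
  obtain ⟨x, -, rfl⟩ := h.cells_eq ▸ hU
  exact connectedComponentIn_subset _ _

theorem cell_eq (h : IsCellDecomposition K 𝒰) (hU : U ∈ 𝒰) (hV : V ∈ 𝒰)
    (hUV : (U ∩ V).Nonempty) : U = V := by
  obtain ⟨x, -, rfl⟩ := h.cells_eq ▸ hU
  obtain ⟨y, -, rfl⟩ := h.cells_eq ▸ hV
  obtain ⟨z, hzx, hzy⟩ := hUV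
  rw [connectedComponentIn_eq hzx, connectedComponentIn_eq hzy]

theorem exists_cell (h : IsCellDecomposition K 𝒰) {x} (hx : x ∈ Disk n \ K) : ∃ U ∈ 𝒰, x ∈ U := by
  rw [h.cells_eq]
  exact ⟨_, ⟨x, hx, rfl⟩, mem_connectedComponentIn hx⟩

theorem nonempty_cell (h : IsCellDecomposition K 𝒰) (hU : U ∈ 𝒰) : U.Nonempty := by
  obtain ⟨x, hx, rfl⟩ := h.cells_eq ▸ hU
  exact ⟨x, mem_connectedComponentIn hx⟩

theorem isBounded_cell (h : IsCellDecomposition K 𝒰) (hU : U ∈ 𝒰) : Bornology.IsBounded U :=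
  Metric.isBounded_closedBall.subset ((h.cell_subset hU).trans sdiff_subset)

theorem closure_cell_subset (h : IsCellDecomposition K 𝒰) (hU : U ∈ 𝒰) : closure U ⊆ Disk n :=
  closure_minimal ((h.cell_subset hU).trans sdiff_subset) Metric.isClosed_closedBall

theorem frontier_cell_subset (h : IsCellDecomposition K 𝒰) (hU : U ∈ 𝒰) : frontier U ⊆ K := by
  intro x hx
  by_contra hxK
  obtain ⟨V, hV, hxV⟩ :=
    h.exists_cell ⟨h.closure_cell_subset hU (frontier_subset_closure hx), hxK⟩
  obtain rfl := h.cell_eq hV hU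
    (mem_closure_iff.1 (frontier_subset_closure hx) V (h.isOpen_cell hV) hxV)
  exact (h.isOpen_cell hU).inter_frontier_eq.subset ⟨hxV, hx⟩

theorem mem_frontier_of_mem_closure (h : IsCellDecomposition K 𝒰) (hU : U ∈ 𝒰) {x}
    (hx : x ∈ closure U) (hxK : x ∈ K) : x ∈ frontier U := by
  rw [(h.isOpen_cell hU).frontier_eq]
  exact ⟨hx, fun hxU => (h.cell_subset hU hxU).2 hxK⟩

theorem mem_of_mem_closure (h : IsCellDecomposition K 𝒰) (hU : U ∈ 𝒰) {x} (hx : x ∈ closure U)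
    (hxK : x ∉ K) : x ∈ U := by
  by_contra hxU
  exact hxK (h.frontier_cell_subset hU ((h.isOpen_cell hU).frontier_eq ▸ ⟨hx, hxU⟩))

theorem cell_eq_of_mem_closure (h : IsCellDecomposition K 𝒰) {U V : 𝒰} {x} (hxK : x ∉ K)
    (hxU : x ∈ closure (U : Set (EuclideanSpace ℝ (Fin n))))
    (hxV : x ∈ closure (V : Set (EuclideanSpace ℝ (Fin n)))) : U = V :=
  Subtype.ext <| h.cell_eq U.2 V.2
    ⟨x, h.mem_of_mem_closure U.2 hxU hxK, h.mem_of_mem_closure V.2 hxV hxK⟩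

theorem mem_or_exists_mem_closure (h : IsCellDecomposition K 𝒰) {x} (hx : x ∈ Disk n) :
    x ∈ K ∨ ∃ U : 𝒰, x ∈ closure (U : Set (EuclideanSpace ℝ (Fin n))) :=
  or_iff_not_imp_left.2 fun hxK =>
    let ⟨U, hU, hxU⟩ := h.exists_cell ⟨hx, hxK⟩
    ⟨⟨U, hU⟩, subset_closure hxU⟩

theorem frontier_cell_nontrivial (hn : n ≠ 0) (h : IsCellDecomposition K 𝒰) (hU : U ∈ 𝒰) :
    (frontier U).Nontrivial := by
  obtain ⟨e⟩ := h.frontier_homeo U hU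
  have := nontrivial_sphere hn
  exact nontrivial_coe_sort.1 e.toEquiv.nontrivial

theorem finite_setOf_le_dist (h : IsCellDecomposition K 𝒰) {ε : ℝ} (hε : 0 < ε) :
    {U : 𝒰 | ∃ x ∈ (U : Set (EuclideanSpace ℝ (Fin n))),
      ∃ y ∈ (U : Set (EuclideanSpace ℝ (Fin n))), ε ≤ dist x y}.Finite := by
  by_contra hinf
  let e := Set.Infinite.natEmbedding _ hinf
  choose x hx y hy hxy using fun k => (e k).2
  have hdisk : ∀ k z, z ∈ ((e k : 𝒰) : Set (EuclideanSpace ℝ (Fin n))) → z ∈ Disk n :=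
    fun k _ hz => (h.cell_subset (e k).1.2 hz).1
  obtain ⟨p, -, φ, hφ, hxp⟩ :=
    (isCompact_closedBall _ _).tendsto_subseq fun k => hdisk k _ (hx k)
  obtain ⟨q, -, ψ, hψ, hyq⟩ :=
    (isCompact_closedBall _ _).tendsto_subseq fun k => hdisk (φ k) _ (hy (φ k))
  replace hxp := hxp.comp hψ.tendsto_atTop
  obtain ⟨θ, hθ, r, hr⟩ := h.exists_lim_eq_singleton (fun k => (e (φ (ψ k))).1)
    (Subtype.val_injective.comp (Subtype.val_injective.comp
      (e.injective.comp (hφ.comp hψ).injective))) (fun k => (e _).1.2)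
  have hpr : p ∈ ({r} : Set _) := hr ▸ ⟨_, fun k => hx _, hxp.comp hθ.tendsto_atTop⟩
  have hqr : q ∈ ({r} : Set _) := hr ▸ ⟨_, fun k => hy _, hyq.comp hθ.tendsto_atTop⟩
  have hle : ε ≤ dist p q := ge_of_tendsto' (hxp.dist hyq) fun k => hxy _
  rw [mem_singleton_iff.1 hpr, mem_singleton_iff.1 hqr, dist_self] at hle
  exact hε.not_ge hle

theorem tendsto_diam (h : IsCellDecomposition K 𝒰) :
    Tendsto (fun U : 𝒰 => Metric.diam (U : Set (EuclideanSpace ℝ (Fin n)))) cofinite (𝓝 0) := by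
  refine Metric.tendsto_nhds.2 fun ε hε => ?_
  filter_upwards [(h.finite_setOf_le_dist (half_pos hε)).eventually_cofinite_notMem] with U hU
  rw [Real.dist_0_eq_abs, abs_of_nonneg Metric.diam_nonneg]
  refine (Metric.diam_le_of_forall_dist_le (half_pos hε).le fun x hx y hy => ?_).trans_lt
    (half_lt_self hε)
  by_contra! hxy
  exact hU ⟨x, hx, y, hy, hxy.le⟩

theorem isNullDecomposition (hn : n ≠ 0) (h : IsCellDecomposition K 𝒰) :
    IsNullDecomposition (Disk n) K fun U : 𝒰 => (U : Set (EuclideanSpace ℝ (Fin n))) where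
  isClosed := h.isClosed
  subset_union _ hx := or_iff_not_imp_left.2 fun hxK =>
    let ⟨U, hU, hxU⟩ := h.exists_cell ⟨hx, hxK⟩
    mem_iUnion.2 ⟨⟨U, hU⟩, hxU⟩
  isBounded U := h.isBounded_cell U.2
  tendsto_diam := h.tendsto_diam
  frontier_subset U := h.frontier_cell_subset U.2
  frontier_nontrivial U := h.frontier_cell_nontrivial hn U.2

end IsCellDecomposition

end CellDecomposition

section Action

variable {n : ℕ} {G : Type*} [Group G] {K : Set (EuclideanSpace ℝ (Fin n))}
  {𝒰 : Set (Set (EuclideanSpace ℝ (Fin n)))} {μ : G →* (K ≃ₜ K)ᵐᵒᵖ}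
  {Φ : ∀ U : 𝒰, Disk n ≃ₜ closure (U : Set (EuclideanSpace ℝ (Fin n)))}

theorem act_one_apply (μ : G →* (K ≃ₜ K)ᵐᵒᵖ) (x : K) : act μ 1 x = x := by
  simp [act]

theorem act_mul_apply (μ : G →* (K ≃ₜ K)ᵐᵒᵖ) (g h : G) (x : K) :
    act μ (g * h) x = act μ h (act μ g x) := by
  simp [act]

theorem act_one_image (μ : G →* (K ≃ₜ K)ᵐᵒᵖ) (s : Set K) : act μ 1 '' s = s := by
  simp [act_one_apply]

theorem act_mul_image (μ : G →* (K ≃ₜ K)ᵐᵒᵖ) (g h : G) (s : Set K) :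
    act μ (g * h) '' s = act μ h '' (act μ g '' s) := by
  simp [act_mul_apply, image_image]

theorem IsMarking.apply_eq_of_frontier_eq (hΦ : IsMarking μ 𝒰 Φ) (h : IsCellDecomposition K 𝒰)
    {U V : 𝒰} (hUV : frontier (U : Set (EuclideanSpace ℝ (Fin n))) = frontier (V : Set _))
    {s : Disk n} (hs : (s : EuclideanSpace ℝ (Fin n)) ∈ Sph n) :
    (Φ U s : EuclideanSpace ℝ (Fin n)) = Φ V s := by
  have hfr := (hΦ.mem_frontier_iff U s).2 hs
  have := hΦ.equivariant 1 U V (by rw [act_one_image, hUV]) ⟨s, h.sphere_subset hs⟩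
    ⟨Φ U s, h.frontier_cell_subset U.2 hfr⟩ s s hs rfl (by rw [act_one_apply]) rfl
  rwa [act_one_apply] at this

theorem IsMarking.cell_eq_of_frontier_eq (hΦ : IsMarking μ 𝒰 Φ) (h : IsCellDecomposition K 𝒰)
    {U V : 𝒰} (hUV : frontier (U : Set (EuclideanSpace ℝ (Fin n))) = frontier (V : Set _)) :
    U = V := by
  let T : C(closure (U : Set (EuclideanSpace ℝ (Fin n))), EuclideanSpace ℝ (Fin n)) :=
    ⟨fun x => Φ V ((Φ U).symm x), by fun_prop⟩
  have hT : ∀ x : closure (U : Set (EuclideanSpace ℝ (Fin n))),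
      (x : EuclideanSpace ℝ (Fin n)) ∈ frontier (U : Set _) → T x = x := fun x hx => by
    obtain ⟨s, rfl⟩ := (Φ U).surjective x
    simpa [T] using (hΦ.apply_eq_of_frontier_eq h hUV ((hΦ.mem_frontier_iff U s).1 hx)).symm
  obtain ⟨y, hy⟩ := h.nonempty_cell U.2
  obtain ⟨x, hxy⟩ := subset_range_of_eqOn_frontier (h.isBounded_cell U.2) T hT hy
  have hyV : y ∈ closure (V : Set (EuclideanSpace ℝ (Fin n))) := hxy ▸ Subtype.coe_prop (Φ V _)
  exact Subtype.ext (h.cell_eq U.2 V.2 (mem_closure_iff.1 hyV U (h.isOpen_cell U.2) hy))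

end Action

section Extension

variable {n : ℕ} {G : Type*} [Group G] {K : Set (EuclideanSpace ℝ (Fin n))}
  {𝒰 : Set (Set (EuclideanSpace ℝ (Fin n)))} {μ : G →* (K ≃ₜ K)ᵐᵒᵖ}

namespace IsGComplex

/-- A choice of the homeomorphisms `Φ^U` of a `G`-complex. -/
noncomputable def marking (h : IsGComplex μ 𝒰) (U : 𝒰) :
    Disk n ≃ₜ closure (U : Set (EuclideanSpace ℝ (Fin n))) :=
  h.exists_marking.choose U

theorem isMarking_marking (h : IsGComplex μ 𝒰) : IsMarking μ 𝒰 h.marking :=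
  h.exists_marking.choose_spec

/-- The cell `μ(g)(U)`, whose boundary is the image of the boundary of `U`. -/
noncomputable def mapCell (h : IsGComplex μ 𝒰) (g : G) (U : 𝒰) : 𝒰 :=
  ⟨(h.action.map_frontier g U U.2).choose, (h.action.map_frontier g U U.2).choose_spec.1⟩

theorem act_image_frontier (h : IsGComplex μ 𝒰) (g : G) (U : 𝒰) :
    act μ g '' within K (frontier (U : Set (EuclideanSpace ℝ (Fin n)))) =
      within K (frontier (h.mapCell g U : Set (EuclideanSpace ℝ (Fin n)))) :=
  (h.action.map_frontier g U U.2).choose_spec.2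

theorem mapCell_eq (h : IsGComplex μ 𝒰) {g : G} {U V : 𝒰}
    (hV : act μ g '' within K (frontier (U : Set (EuclideanSpace ℝ (Fin n)))) =
      within K (frontier (V : Set (EuclideanSpace ℝ (Fin n))))) : h.mapCell g U = V := by
  refine h.isMarking_marking.cell_eq_of_frontier_eq h.cellDecomposition ?_
  have hsub : ∀ W : 𝒰, frontier (W : Set _) ⊆ range (Subtype.val : K → _) :=
    fun W => by simpa using h.cellDecomposition.frontier_cell_subset W.2
  exact (preimage_eq_preimage' (hsub _) (hsub _)).1 ((h.act_image_frontier g U).symm.trans hV)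

theorem mapCell_one (h : IsGComplex μ 𝒰) (U : 𝒰) : h.mapCell 1 U = U :=
  h.mapCell_eq (act_one_image μ _)

theorem mapCell_mul (h : IsGComplex μ 𝒰) (g k : G) (U : 𝒰) :
    h.mapCell (g * k) U = h.mapCell k (h.mapCell g U) :=
  h.mapCell_eq (by rw [act_mul_image, h.act_image_frontier, h.act_image_frontier])

theorem mapCell_injective (h : IsGComplex μ 𝒰) (g : G) : Function.Injective (h.mapCell g) :=
  Function.LeftInverse.injective (g := h.mapCell g⁻¹) fun U => by
    rw [← h.mapCell_mul, mul_inv_cancel, h.mapCell_one]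

theorem eq_one_of_mapCell_eq (h : IsGComplex μ 𝒰) (hstab : ∀ U ∈ 𝒰, stab μ U = {1}) {g : G}
    {U : 𝒰} (hg : h.mapCell g U = U) : g = 1 := by
  have hmem : g ∈ stab μ (U : Set (EuclideanSpace ℝ (Fin n))) :=
    (h.act_image_frontier g U).trans (by rw [hg])
  rwa [hstab U U.2] at hmem

theorem mapCell_left_injective (h : IsGComplex μ 𝒰) (hstab : ∀ U ∈ 𝒰, stab μ U = {1}) (U : 𝒰) :
    Function.Injective (h.mapCell · U) := fun g k (hgk : h.mapCell g U = h.mapCell k U) =>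
  mul_inv_eq_one.1 <| h.eq_one_of_mapCell_eq hstab (U := U) <| by
    rw [h.mapCell_mul, hgk, ← h.mapCell_mul, mul_inv_cancel, h.mapCell_one]

/-- The homeomorphism of `S^{n-1}` induced by `μ(g)`. -/
noncomputable def sphereHomeo (h : IsGComplex μ 𝒰) (g : G) : Sph n ≃ₜ Sph n :=
  (h.action.orientation g).choose

theorem act_eq_sphereHomeo (h : IsGComplex μ 𝒰) (g : G) {x : K} {s : Sph n}
    (hxs : (x : EuclideanSpace ℝ (Fin n)) = s) :
    (act μ g x : EuclideanSpace ℝ (Fin n)) = h.sphereHomeo g s :=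
  (h.action.orientation g).choose_spec.2 x s hxs

theorem sphereHomeo_one (h : IsGComplex μ 𝒰) : ⇑(h.sphereHomeo 1) = id := by
  funext s
  refine Subtype.ext ?_
  rw [← h.act_eq_sphereHomeo 1 (x := ⟨s, h.cellDecomposition.sphere_subset s.2⟩) rfl,
    act_one_apply, id]

theorem sphereHomeo_mul (h : IsGComplex μ 𝒰) (g k : G) :
    ⇑(h.sphereHomeo (g * k)) = h.sphereHomeo k ∘ h.sphereHomeo g := by
  funext s
  refine Subtype.ext ?_
  rw [← h.act_eq_sphereHomeo (g * k) (x := ⟨s, h.cellDecomposition.sphere_subset s.2⟩) rfl,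
    act_mul_apply]
  exact h.act_eq_sphereHomeo k (h.act_eq_sphereHomeo g rfl)

/-- The map from the closure of `U` to that of `μ(g)(U)` that the marking transports from the cone
of `μ(g)` on `S^{n-1}`. -/
noncomputable def cellMap (h : IsGComplex μ 𝒰) (g : G) (U : 𝒰)
    (x : closure (U : Set (EuclideanSpace ℝ (Fin n)))) :
    closure (h.mapCell g U : Set (EuclideanSpace ℝ (Fin n))) :=
  h.marking _ ⟨coneMap (h.sphereHomeo g) ((h.marking U).symm x),
    coneMap_mem_closedBall (Subtype.coe_prop _)⟩

theorem continuous_cellMap (h : IsGComplex μ 𝒰) (g : G) (U : 𝒰) : Continuous (h.cellMap g U) := by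
  have := continuous_coneMap (h.sphereHomeo g).continuous
  unfold cellMap
  fun_prop

theorem cellMap_one (h : IsGComplex μ 𝒰) (U : 𝒰)
    (x : closure (U : Set (EuclideanSpace ℝ (Fin n)))) :
    (h.cellMap 1 U x : EuclideanSpace ℝ (Fin n)) = x := by
  simp only [cellMap, h.sphereHomeo_one, coneMap_id, Subtype.coe_eta]
  rw [h.mapCell_one, Homeomorph.apply_symm_apply]

theorem cellMap_mul (h : IsGComplex μ 𝒰) (g k : G) (U : 𝒰)
    (x : closure (U : Set (EuclideanSpace ℝ (Fin n)))) :
    (h.cellMap (g * k) U x : EuclideanSpace ℝ (Fin n)) =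
      h.cellMap k (h.mapCell g U) (h.cellMap g U x) := by
  simp only [cellMap, h.sphereHomeo_mul, coneMap_comp, Homeomorph.symm_apply_apply]
  rw [h.mapCell_mul]

theorem cellMap_of_mem (h : IsGComplex μ 𝒰) (g : G) (U : 𝒰)
    (x : closure (U : Set (EuclideanSpace ℝ (Fin n)))) (hx : (x : EuclideanSpace ℝ (Fin n)) ∈ K) :
    (h.cellMap g U x : EuclideanSpace ℝ (Fin n)) = act μ g ⟨x, hx⟩ := by
  obtain ⟨s, rfl⟩ := (h.marking U).surjective x
  have hs : (s : EuclideanSpace ℝ (Fin n)) ∈ Sph n :=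
    (h.isMarking_marking.mem_frontier_iff U s).1
      (h.cellDecomposition.mem_frontier_of_mem_closure U.2 (Subtype.coe_prop _) hx)
  refine (h.isMarking_marking.equivariant g U _ (h.act_image_frontier g U)
    ⟨s, h.cellDecomposition.sphere_subset hs⟩ _ s _ hs rfl ?_ rfl).symm
  rw [h.act_eq_sphereHomeo g (s := ⟨s, hs⟩) rfl]
  simp only [Homeomorph.symm_apply_apply]
  exact coneMap_coe (⟨s, hs⟩ : Sph n)

open Classical in
/-- The extension of `μ(g)` over `D^n` by the maps of the cells. It is defined on all of `ℝ^n`, with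
the identity as junk value outside `D^n`. -/
noncomputable def extend (h : IsGComplex μ 𝒰) (g : G) (x : EuclideanSpace ℝ (Fin n)) :
    EuclideanSpace ℝ (Fin n) :=
  if hK : x ∈ K then act μ g ⟨x, hK⟩
  else if hU : ∃ U : 𝒰, x ∈ closure (U : Set (EuclideanSpace ℝ (Fin n))) then
    h.cellMap g hU.choose ⟨x, hU.choose_spec⟩
  else x

theorem extend_coe (h : IsGComplex μ 𝒰) (g : G) (x : K) : h.extend g x = act μ g x :=
  dif_pos x.2

theorem extend_closure (h : IsGComplex μ 𝒰) (g : G) {U : 𝒰}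
    (x : closure (U : Set (EuclideanSpace ℝ (Fin n)))) : h.extend g x = h.cellMap g U x := by
  by_cases hxK : (x : EuclideanSpace ℝ (Fin n)) ∈ K
  · rw [h.cellMap_of_mem g U x hxK, ← h.extend_coe]
  · have hex : ∃ V : 𝒰, (x : EuclideanSpace ℝ (Fin n)) ∈ closure (V : Set _) := ⟨U, x.2⟩
    obtain ⟨V, hV, heq⟩ : ∃ (V : 𝒰) (hV : (x : EuclideanSpace ℝ (Fin n)) ∈
        closure (V : Set (EuclideanSpace ℝ (Fin n)))), h.extend g x = h.cellMap g V ⟨x, hV⟩ :=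
      ⟨_, hex.choose_spec, by rw [extend, dif_neg hxK, dif_pos hex]⟩
    obtain rfl := h.cellDecomposition.cell_eq_of_mem_closure hxK hV x.2
    exact heq

theorem mapsTo_extend_closure (h : IsGComplex μ 𝒰) (g : G) (U : 𝒰) :
    MapsTo (h.extend g) (closure (U : Set (EuclideanSpace ℝ (Fin n))))
      (closure (h.mapCell g U : Set (EuclideanSpace ℝ (Fin n)))) := fun x hx => by
  rw [h.extend_closure g ⟨x, hx⟩]
  exact Subtype.coe_prop _

theorem surjOn_extend_frontier (h : IsGComplex μ 𝒰) (g : G) (U : 𝒰) :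
    SurjOn (h.extend g) (frontier (U : Set (EuclideanSpace ℝ (Fin n))))
      (frontier (h.mapCell g U : Set (EuclideanSpace ℝ (Fin n)))) := fun y hy => by
  have hyK : y ∈ K := h.cellDecomposition.frontier_cell_subset (Subtype.coe_prop _) hy
  obtain ⟨x, hx, hxy⟩ : (⟨y, hyK⟩ : K) ∈
      act μ g '' within K (frontier (U : Set (EuclideanSpace ℝ (Fin n)))) :=
    (h.act_image_frontier g U).symm ▸ hy
  exact ⟨x, hx, by rw [h.extend_coe, hxy]⟩

theorem mapsTo_extend (h : IsGComplex μ 𝒰) (g : G) : MapsTo (h.extend g) (Disk n) (Disk n) := by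
  intro x hx
  rcases h.cellDecomposition.mem_or_exists_mem_closure hx with hxK | ⟨U, hxU⟩
  · rw [h.extend_coe g ⟨x, hxK⟩]
    exact h.cellDecomposition.subset_disk (Subtype.coe_prop _)
  · exact h.cellDecomposition.closure_cell_subset (Subtype.coe_prop _)
      (h.mapsTo_extend_closure g U hxU)

theorem extend_one (h : IsGComplex μ 𝒰) {x : EuclideanSpace ℝ (Fin n)} (hx : x ∈ Disk n) :
    h.extend 1 x = x := by
  rcases h.cellDecomposition.mem_or_exists_mem_closure hx with hxK | ⟨U, hxU⟩
  · rw [h.extend_coe 1 ⟨x, hxK⟩, act_one_apply]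
  · rw [h.extend_closure 1 ⟨x, hxU⟩, h.cellMap_one]

theorem extend_mul (h : IsGComplex μ 𝒰) (g k : G) {x : EuclideanSpace ℝ (Fin n)}
    (hx : x ∈ Disk n) : h.extend (g * k) x = h.extend k (h.extend g x) := by
  rcases h.cellDecomposition.mem_or_exists_mem_closure hx with hxK | ⟨U, hxU⟩
  · lift x to K using hxK
    simp only [h.extend_coe, act_mul_apply]
  · lift x to closure (U : Set (EuclideanSpace ℝ (Fin n))) using hxU
    simp only [h.extend_closure, h.cellMap_mul]

theorem continuousOn_extend (hn : n ≠ 0) (h : IsGComplex μ 𝒰) (g : G) :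
    ContinuousOn (h.extend g) (Disk n) := by
  refine (h.cellDecomposition.isNullDecomposition hn).continuousOn_of_mapsTo_closure ?_
    (fun U => ?_) (h.mapCell_injective g) (h.mapsTo_extend_closure g)
  · refine continuousOn_iff_continuous_domRestrict.2 ?_
    exact (continuous_subtype_val.comp (act μ g).continuous).congr fun x => (h.extend_coe g x).symm
  · refine continuousOn_iff_continuous_domRestrict.2 ?_
    exact (continuous_subtype_val.comp (h.continuous_cellMap g U)).congr
      fun x => (h.extend_closure g x).symm

/-- The action on `D^n` by the extensions of the homeomorphisms `μ(g)`. -/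
noncomputable def extendHom (hn : n ≠ 0) (h : IsGComplex μ 𝒰) : G →* (Disk n ≃ₜ Disk n)ᵐᵒᵖ where
  toFun g := MulOpposite.op
    { toFun := (h.mapsTo_extend g).restrict
      invFun := (h.mapsTo_extend g⁻¹).restrict
      left_inv := fun x => Subtype.ext <|
        (h.extend_mul g g⁻¹ x.2).symm.trans (by rw [mul_inv_cancel, h.extend_one x.2])
      right_inv := fun x => Subtype.ext <|
        (h.extend_mul g⁻¹ g x.2).symm.trans (by rw [inv_mul_cancel, h.extend_one x.2])
      continuous_toFun := (h.continuousOn_extend hn g).mapsToRestrict _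
      continuous_invFun := (h.continuousOn_extend hn g⁻¹).mapsToRestrict _ }
  map_one' := MulOpposite.unop_injective <| Homeomorph.ext fun x => Subtype.ext <|
    h.extend_one x.2
  map_mul' g k := MulOpposite.unop_injective <| Homeomorph.ext fun x => Subtype.ext <|
    h.extend_mul g k x.2

theorem act_extendHom (hn : n ≠ 0) (h : IsGComplex μ 𝒰) (g : G) (x : Disk n) :
    (act (h.extendHom hn) g x : EuclideanSpace ℝ (Fin n)) = h.extend g x :=
  rfl

end IsGComplex

end Extension

section Refinement

variable {n : ℕ} {G : Type*} [Group G] {K K₀ : Set (EuclideanSpace ℝ (Fin n))}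
  {𝒰 : Set (Set (EuclideanSpace ℝ (Fin n)))} {μ : G →* (K ≃ₜ K)ᵐᵒᵖ} {μ₀ : G →* (K₀ ≃ₜ K₀)ᵐᵒᵖ}

theorem isConvergence_iff (hK : IsClosed K) (hμ : Function.Injective μ) :
    IsConvergence μ ↔ ∀ g : ℕ → G, Function.Injective g → ∃ φ : ℕ → ℕ, StrictMono φ ∧
      ∃ a b : K, TendstoLocallyUniformlyOn (fun k => act μ (g (φ k))) (fun _ => a) atTop {b}ᶜ := by
  have : LocallyCompactSpace K := hK.isClosedEmbedding_subtypeVal.locallyCompactSpace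
  have hact : Function.Injective (act μ) := MulOpposite.unop_injective.comp hμ
  simp only [tendstoLocallyUniformlyOn_iff_forall_isCompact isOpen_compl_singleton,
    subset_compl_singleton_iff]
  constructor
  · intro h g hg
    obtain ⟨φ, hφ, a, b, hab⟩ := h (fun k => act μ (g k)) (hact.comp hg) fun k => ⟨g k, rfl⟩
    exact ⟨φ, hφ, a, b, fun C hb hC => hab C hC hb⟩
  · intro h f hf hmem
    choose g hg using hmem
    obtain rfl : f = fun k => act μ (g k) := funext fun k => (congrArg MulOpposite.unop (hg k)).symm
    obtain ⟨φ, hφ, a, b, hab⟩ := h g (Function.Injective.of_comp (f := act μ) hf)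
    exact ⟨φ, hφ, a, b, fun C hC hb => hab C hb hC⟩

theorem isCellDecomposition_empty : IsCellDecomposition (Disk n) ∅ where
  subset_disk := Subset.rfl
  isClosed := Metric.isClosed_closedBall
  cells_eq := by simp [components]
  sphere_subset := Metric.sphere_subset_closedBall
  cell_homeo _ hU := hU.elim
  frontier_homeo _ hU := hU.elim
  exists_lim_eq_singleton _ _ hU := (hU 0).elim

theorem IsGAction.isGComplex_empty {μ : G →* (Disk n ≃ₜ Disk n)ᵐᵒᵖ} (h : IsGAction μ ∅) :
    IsGComplex μ ∅ where
  cellDecomposition := isCellDecomposition_empty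
  action := h
  exists_marking := ⟨isEmptyElim, isEmptyElim, isEmptyElim, fun _ => isEmptyElim⟩

namespace IsRefinement

theorem semiconj (h : IsRefinement μ₀ μ) (g : G) :
    Function.Semiconj (inclusion h.1) (act μ g) (act μ₀ g) := fun x =>
  Subtype.ext (h.2 g (inclusion h.1 x) x rfl).symm

theorem injective (h : IsRefinement μ₀ μ) (hμ : Function.Injective μ) : Function.Injective μ₀ := by
  intro g k hgk
  refine hμ (MulOpposite.unop_injective (Homeomorph.ext fun x => inclusion_injective h.1 ?_))
  have hact : act μ₀ g = act μ₀ k := congrArg MulOpposite.unop hgk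
  exact (h.semiconj g x).trans (hact ▸ (h.semiconj k x).symm)

theorem isGAction_empty (h : IsRefinement μ₀ μ) (hμ : IsGAction μ 𝒰) (hK : Sph n ⊆ K) :
    IsGAction μ₀ ∅ where
  faithful := h.injective hμ.faithful
  map_sphere g := by
    have heq : within K₀ (Sph n) = inclusion h.1 '' within K (Sph n) := by
      ext x
      exact ⟨fun hx => ⟨⟨x, hK hx⟩, hx, rfl⟩, by rintro ⟨y, hy, rfl⟩; exact hy⟩
    rw [heq, ← (h.semiconj g).set_image, hμ.map_sphere]
  map_frontier _ _ hU := hU.elim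
  orientation g := by
    obtain ⟨f, hf, hfg⟩ := hμ.orientation g
    refine ⟨f, hf, fun x s hxs => ?_⟩
    rw [h.2 g x ⟨s, hK s.2⟩ hxs, hfg _ s rfl]

end IsRefinement

namespace IsGComplex

theorem isRefinement_extendHom (hn : n ≠ 0) (h : IsGComplex μ 𝒰) :
    IsRefinement (h.extendHom hn) μ :=
  ⟨h.cellDecomposition.subset_disk, fun g x x' hxx' => by
    rw [h.act_extendHom, hxx', h.extend_coe]⟩

theorem isFree_extendHom (hn : n ≠ 0) (h : IsGComplex μ 𝒰) (hfree : IsFree μ)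
    (hstab : ∀ U ∈ 𝒰, stab μ U = {1}) : IsFree (h.extendHom hn) := by
  intro g hg x hx hfix
  replace hfix : h.extend g x = x := congrArg Subtype.val hfix
  by_cases hxK : (x : EuclideanSpace ℝ (Fin n)) ∈ K
  · exact hfree g hg ⟨x, hxK⟩ hx (Subtype.ext ((h.extend_coe g ⟨x, hxK⟩).symm.trans hfix))
  · obtain ⟨U, hxU⟩ := (h.cellDecomposition.mem_or_exists_mem_closure x.2).resolve_left hxK
    have hgxU := h.mapsTo_extend_closure g U hxU
    rw [hfix] at hgxU
    exact hg (h.eq_one_of_mapCell_eq hstab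
      (h.cellDecomposition.cell_eq_of_mem_closure hxK hgxU hxU))

theorem isConvergence_extendHom (hn : n ≠ 0) (h : IsGComplex μ 𝒰) (hconv : IsConvergence μ)
    (hstab : ∀ U ∈ 𝒰, stab μ U = {1}) : IsConvergence (h.extendHom hn) := by
  have hfaithful := (h.isRefinement_extendHom hn).injective h.action.faithful
  rw [isConvergence_iff Metric.isClosed_closedBall hfaithful]
  intro g hg
  obtain ⟨φ, hφ, a, b, hab⟩ :=
    (isConvergence_iff h.cellDecomposition.isClosed h.action.faithful).1 hconv g hg
  have hK := h.cellDecomposition.subset_disk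
  refine ⟨φ, hφ, inclusion hK a, inclusion hK b, ?_⟩
  have hcells : ∀ U, Tendsto (fun k => h.mapCell (g (φ k)) U) atTop cofinite := fun U =>
    Nat.cofinite_eq_atTop ▸ ((h.mapCell_left_injective hstab U).comp
      (hg.comp hφ.injective)).tendsto_cofinite
  exact (tendstoLocallyUniformlyOn_const_subtype_iff fun _ _ => rfl).2 <|
    (h.cellDecomposition.isNullDecomposition hn).tendstoLocallyUniformlyOn_const
      (fun k => h.mapsTo_extend_closure (g (φ k))) (fun k => h.surjOn_extend_frontier (g (φ k)))
      hcells <|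
    (tendstoLocallyUniformlyOn_const_subtype_iff fun k x => (h.extend_coe (g (φ k)) x).symm).1 hab

end IsGComplex

end Refinement

end GComplexes

theorem proposition3_general {n : ℕ} (hn : n ≠ 0) {G : Type*} [Group G]
    (K : Set (EuclideanSpace ℝ (Fin n))) (𝒰 : Set (Set (EuclideanSpace ℝ (Fin n))))
    (μ : G →* (K ≃ₜ K)ᵐᵒᵖ)
    (hcomplex : GComplexes.IsGComplex μ 𝒰)
    (hfree : GComplexes.IsFree μ)
    (hconv : GComplexes.IsConvergence μ)
    (hstab : ∀ U ∈ 𝒰, GComplexes.stab μ U = {1}) :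
    ∃ μ₀ : G →* (GComplexes.Disk n ≃ₜ GComplexes.Disk n)ᵐᵒᵖ,
      GComplexes.IsGComplex μ₀ ∅ ∧ GComplexes.IsFree μ₀ ∧ GComplexes.IsConvergence μ₀ ∧
        GComplexes.IsRefinement μ₀ μ := by
  have hrefine := hcomplex.isRefinement_extendHom hn
  have haction := hrefine.isGAction_empty hcomplex.action hcomplex.cellDecomposition.sphere_subset
  exact ⟨hcomplex.extendHom hn, haction.isGComplex_empty, hcomplex.isFree_extendHom hn hfree hstab,
    hcomplex.isConvergence_extendHom hn hconv hstab, hrefine⟩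

theorem proposition3 {n : ℕ} (hn : 3 ≤ n) {G : Type*} [Group G]
    (K : Set (EuclideanSpace ℝ (Fin n))) (𝒰 : Set (Set (EuclideanSpace ℝ (Fin n))))
    (μ : G →* (K ≃ₜ K)ᵐᵒᵖ)
    (hcomplex : GComplexes.IsGComplex μ 𝒰)
    (hfree : GComplexes.IsFree μ)
    (hconv : GComplexes.IsConvergence μ)
    (hstab : ∀ U ∈ 𝒰, GComplexes.stab μ U = {1}) :
    ∃ μ₀ : G →* (GComplexes.Disk n ≃ₜ GComplexes.Disk n)ᵐᵒᵖ,
      GComplexes.IsGComplex μ₀ ∅ ∧ GComplexes.IsFree μ₀ ∧ GComplexes.IsConvergence μ₀ ∧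
        GComplexes.IsRefinement μ₀ μ :=
  proposition3_general (by omega) K 𝒰 μ hcomplex hfree hconv hstab
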